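/- Let $n\ge 3$, let $d$ be a metric on $\{1,\dots,n\}$ (symmetric, zero on the diagonal, positive off the diagonal, satisfying the triangle inequality), and put $P_d=\{x\in\mathbb R^n : x_i+x_j\ge d(i,j)\text{ for all }i,j\}$, where $i=j$ is allowed. Call $d$ generic if the polyhedron $P_d$ is simple, i.e. each of its vertices lies in exactly $n$ facets. A graph $\Gamma$ on the vertex set $\{1,\dots,n\}$ is called a cell of $\Delta^d$ (the regular subdivision of the second hypersimplex $\mathrm{conv}\{e_i+e_j : 1\le i<j\le n\}$ induced by $d$, the edge $\{i,j\}$ standing for the vertex $e_i+e_j$) if there is $\lambda\in\mathbb R^n$ such that $\lambda_i+\lambda_j=d(i,j)$ for every edge $\{i,j\}$ of $\Gamma$ and $\lambda_i+\lambda_j>d(i,j)$ for all $i\ne j$ such that $\{i,j\}$ is not an edge of $\Gamma$. Suppose that $d$ is generic and that, for all $1\le i\le j\le k\le l\le n$, \[ d(i,j)-d(i,k)\le d(j,l)-d(k,l)\quad\text{and}\quad d(i,l)-d(i,k)\le d(j,l)-d(j,k). \] If $n$ is odd, then the cycle \[ C=\bigl(1,\tfrac{n+1}{2}+1,\,2,\tfrac{n+1}{2}+2,\,\dots,\tfrac{n-1}{2},\,n,\,\tfrac{n+1}{2},\,1\bigr)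 \] is a cell of $\Delta^d$. If $n$ is even, then the graph $D$ consisting of the cycle \[ C'=\bigl(1,\tfrac n2+2,\,2,\tfrac n2+3,\,\dots,\tfrac n2-1,\,n,\,\tfrac n2,\,1\bigr) \] and the additional edge $\{1,\tfrac n2+1\}$ is a cell of $\Delta^d$. Moreover, for every $n\ge 4$ the function $d_{\max}^n$ on $\{1,\dots,n\}$ that is symmetric, zero on the diagonal, and given by $d_{\max}^n(i,j)=1+\frac{1}{n^2+in+j}$ for $1\le i<j\le n$, is a generic metric that satisfies these two inequalities, so that the above applies to $d=d_{\max}^n$. -/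

import Mathlib

/-- A metric on `n` points, given by its distance matrix. -/
structure IsMetric {n : ℕ} (d : Fin n → Fin n → ℝ) : Prop where
  diag : ∀ i, d i i = 0
  symm : ∀ i j, d i j = d j i
  pos : ∀ i j, i ≠ j → 0 < d i j
  triangle : ∀ i j k, d i k ≤ d i j + d j k

/-- The polyhedron `P_d` of all `x` with `x i + x j ≥ d i j` for all `i, j`, where `i = j` is
allowed. -/
def metricPolyhedron {n : ℕ} (d : Fin n → Fin n → ℝ) : Set (Fin n → ℝ) :=
  {x | ∀ i j, d i j ≤ x i + x j}

/-- A facet of a convex set: a non-empty exposed face whose dimension is one less. -/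
def IsFacet {n : ℕ} (P F : Set (Fin n → ℝ)) : Prop :=
  IsExposed ℝ P F ∧ F.Nonempty ∧
    Module.finrank ℝ (vectorSpan ℝ F) + 1 = Module.finrank ℝ (vectorSpan ℝ P)

/-- A polyhedron is simple if each vertex is contained in exactly `dim P` facets. -/
def IsSimplePolyhedron {n : ℕ} (P : Set (Fin n → ℝ)) : Prop :=
  ∀ v ∈ P.extremePoints ℝ,
    {F : Set (Fin n → ℝ) | IsFacet P F ∧ v ∈ F}.encard =
      (Module.finrank ℝ (vectorSpan ℝ P) : ℕ∞)

/-- The metric `d` is generic if the polyhedron `P_d` is simple. -/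
def IsGeneric {n : ℕ} (d : Fin n → Fin n → ℝ) : Prop :=
  IsSimplePolyhedron (metricPolyhedron d)

/-- The graph `Γ` is a cell of the regular subdivision `Δ^d` of the second hypersimplex: the vertex
`e_i + e_j` of the hypersimplex is the edge `{i, j}` of the complete graph, it has height `d i j`,
and a cell is the set of vertices where a linear functional `ht` that is nowhere below the heights
agrees with them. -/
def IsCell {n : ℕ} (d : Fin n → Fin n → ℝ) (Γ : SimpleGraph (Fin n)) : Prop :=
  ∃ ht : Fin n → ℝ, ∀ i j, i ≠ j →
    (Γ.Adj i j → ht i + ht j = d i j) ∧ (¬ Γ.Adj i j → d i j < ht i + ht j)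

/-- The two exchange inequalities. -/
def ExchangeInequalities {n : ℕ} (d : Fin n → Fin n → ℝ) : Prop :=
  ∀ i j k l : Fin n, i ≤ j → j ≤ k → k ≤ l →
    d i j - d i k ≤ d j l - d k l ∧ d i l - d i k ≤ d j l - d j k

/-- The label in `{1, …, n}` of a point of `Fin n`. -/
def label {n : ℕ} (i : Fin n) : ℕ := (i : ℕ) + 1

/-- The metric with `d(i, j) = 1 + 1 / (n² + i n + j)` for labels `1 ≤ i < j ≤ n`. -/
noncomputable def dMax (n : ℕ) (i j : Fin n) : ℝ :=
  if i = j then 0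
  else 1 + 1 / ((n : ℝ) ^ 2 + (label (min i j) : ℝ) * (n : ℝ) + (label (max i j) : ℝ))

/-- The graph of the closed walk `(c 0, c 1, …, c (L - 1), c 0)`, where `c` takes values in the
labels. -/
def closedWalkGraph (n L : ℕ) (c : ℕ → ℕ) : SimpleGraph (Fin n) :=
  SimpleGraph.fromRel fun i j => ∃ t < L, label i = c t ∧ label j = c ((t + 1) % L)

/-- For `n` odd, the sequence `1, (n+1)/2 + 1, 2, (n+1)/2 + 2, …, (n-1)/2, n, (n+1)/2` of `n`
labels. -/
def oddSeq (n t : ℕ) : ℕ := if t % 2 = 0 then t / 2 + 1 else (n + 1) / 2 + (t / 2 + 1)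

/-- For `n` even, the sequence `1, n/2 + 2, 2, n/2 + 3, …, n/2 - 1, n, n/2` of `n - 1` labels. -/
def evenSeq (n t : ℕ) : ℕ := if t % 2 = 0 then t / 2 + 1 else n / 2 + (t / 2 + 2)

/-- The cycle `C = (1, (n+1)/2 + 1, 2, (n+1)/2 + 2, …, (n-1)/2, n, (n+1)/2, 1)` (`n` odd). -/
def oddCycle (n : ℕ) : SimpleGraph (Fin n) := closedWalkGraph n n (oddSeq n)

/-- The graph `D`: the cycle `(1, n/2 + 2, 2, n/2 + 3, …, n/2 - 1, n, n/2, 1)` together with the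
edge `{1, n/2 + 1}` (`n` even). -/
def evenCycleWithEdge (n : ℕ) : SimpleGraph (Fin n) :=
  closedWalkGraph n (n - 1) (evenSeq n) ⊔
    SimpleGraph.fromRel fun i j => label i = 1 ∧ label j = n / 2 + 1

/-! Call `x i + x j - d i j` the slack of the pair `{i, j}` at `x`. For each parity a point of `P_d`
is constructed at which every edge of the graph has slack zero. The graph is connected with a single
cycle, of odd length, so the equations `u i + u j = 0` along its edges force `u = 0`, and the point
is a vertex. Facets of `P_d` correspond to pairs, loops allowed, because every pair is the only
tight one at some point of `P_d`. Genericity therefore says that exactly `n` pairs are tight at a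
vertex; the edges already account for `n`, so all other slacks are positive
(`isCell_of_forall_eq_zero`).

The exchange inequalities put the point in `P_d`: among the three pairings of four points in cyclic
order, the crossing one is longest. For `n = 2 * m + 1` the edges are the long diagonals of a
polygon. An odd cycle of equations determines the heights, and the inequalities carry nonnegativity
of the slack from long diagonals to all pairs (`nonneg_of_long_diagonals`). For even `n`, the label
`n / 2 + 1` is left out, the odd case is applied, and that vertex is attached by the pendant edge to
label `1`.

For `dMax` the exchange and triangle inequalities are strict when the points involved are distinct.
Two different tight pairs then never have the same sum modulo `n`, so at most `n` are tight at any
point of the polyhedron (`encard_tightPairs_le`). -/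

/-! ### Facets and vertices of the metric polyhedron. -/

section Polyhedron

variable {n : ℕ} {d : Fin n → Fin n → ℝ}

/-- The pairs `{i, j}` (loops allowed) whose inequality is tight at `x`. -/
def tightPairs (d : Fin n → Fin n → ℝ) (x : Fin n → ℝ) : Set (Sym2 (Fin n)) :=
  {p | ∃ i j, s(i, j) = p ∧ x i + x j = d i j}

/-- The face of the metric polyhedron on which the inequality of the pair `p` is tight. -/
def pairFace (d : Fin n → Fin n → ℝ) (p : Sym2 (Fin n)) : Set (Fin n → ℝ) :=
  {x | x ∈ metricPolyhedron d ∧ p ∈ tightPairs d x}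

theorem mk_mem_tightPairs (hs : ∀ i j, d i j = d j i) {x : Fin n → ℝ} {i j : Fin n} :
    s(i, j) ∈ tightPairs d x ↔ x i + x j = d i j := by
  constructor
  · rintro ⟨k, l, hkl, h⟩
    rcases Sym2.eq_iff.1 hkl with ⟨rfl, rfl⟩ | ⟨rfl, rfl⟩
    · exact h
    · rw [hs, add_comm]; exact h
  · exact fun h => ⟨i, j, rfl, h⟩

/-- A direction orthogonal to all tight inequalities can be followed both ways. -/
theorem exists_pos_forall_add_smul_mem {x u : Fin n → ℝ} (hx : x ∈ metricPolyhedron d)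
    (hu : ∀ i j, x i + x j = d i j → u i + u j = 0) :
    ∃ ε > 0, ∀ t : ℝ, |t| ≤ ε → x + t • u ∈ metricPolyhedron d := by
  have key : ∀ p : Fin n × Fin n, ∀ᶠ t in nhds (0 : ℝ),
      d p.1 p.2 ≤ (x + t • u) p.1 + (x + t • u) p.2 := by
    rintro ⟨i, j⟩
    rcases (hx i j).eq_or_lt with h | h
    · refine Filter.Eventually.of_forall fun t => ?_
      have h0 := hu i j h.symm
      simp only [Pi.add_apply, Pi.smul_apply, smul_eq_mul]
      have : x i + t * u i + (x j + t * u j) = x i + x j + t * (u i + u j) := by ring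
      rw [this, h0, h]; simp
    · have hc : Continuous fun t : ℝ => (x + t • u) i + (x + t • u) j := by
        simp only [Pi.add_apply, Pi.smul_apply, smul_eq_mul]; fun_prop
      have h1 : d i j < (fun t : ℝ => (x + t • u) i + (x + t • u) j) 0 := by simpa using h
      exact (hc.continuousAt.eventually_const_lt h1).mono fun t ht => ht.le
  obtain ⟨ε, hε, h⟩ := Metric.eventually_nhds_iff.1 (Filter.eventually_all.2 key)
  refine ⟨ε / 2, half_pos hε, fun t ht i j => h (y := t) ?_ (i, j)⟩
  rw [Real.dist_eq, sub_zero]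
  linarith

theorem convex_metricPolyhedron : Convex ℝ (metricPolyhedron d) := by
  intro x hx y hy a b ha hb hab i j
  have h1 := mul_le_mul_of_nonneg_left (hx i j) ha
  have h2 := mul_le_mul_of_nonneg_left (hy i j) hb
  have : d i j = a * d i j + b * d i j := by rw [← add_mul, hab, one_mul]
  simp only [Pi.add_apply, Pi.smul_apply, smul_eq_mul]
  linarith

/-- The linear functional `u ↦ u i + u j`. -/
noncomputable def pairFunctional (i j : Fin n) : (Fin n → ℝ) →L[ℝ] ℝ :=
  (ContinuousLinearMap.proj i : (Fin n → ℝ) →L[ℝ] ℝ) + ContinuousLinearMap.proj j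

@[simp] theorem pairFunctional_apply (i j : Fin n) (u : Fin n → ℝ) :
    pairFunctional i j u = u i + u j := rfl

theorem finrank_ker_pairFunctional (i j : Fin n) :
    Module.finrank ℝ (LinearMap.ker (pairFunctional i j : (Fin n → ℝ) →ₗ[ℝ] ℝ)) + 1 = n := by
  have h : (pairFunctional i j : (Fin n → ℝ) →ₗ[ℝ] ℝ) ≠ 0 := by
    intro h
    have := congrArg (fun f : (Fin n → ℝ) →ₗ[ℝ] ℝ => f 1) h
    norm_num at this
  have := Module.Dual.finrank_ker_add_one_of_ne_zero h
  simpa using this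

/-- Every pair is tight alone at some point of the polyhedron. -/
theorem exists_tightPairs_eq_singleton (hd : IsMetric d) (i j : Fin n) :
    ∃ x ∈ metricPolyhedron d, x i + x j = d i j ∧
      ∀ k l, x k + x l = d k l → s(k, l) = s(i, j) := by
  have hnn : ∀ k l, 0 ≤ d k l := fun k l => by
    rcases eq_or_ne k l with rfl | h
    · exact (hd.diag k).ge
    · exact (hd.pos k l h).le
  obtain ⟨M, hM0, hM⟩ : ∃ M : ℝ, 0 < M ∧ ∀ k l, d k l < M := by
    refine ⟨1 + ∑ k, ∑ l, d k l, ?_, fun k l => ?_⟩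
    · have : 0 ≤ ∑ k, ∑ l, d k l :=
        Finset.sum_nonneg fun k _ => Finset.sum_nonneg fun l _ => hnn k l
      linarith
    · have h1 : d k l ≤ ∑ l, d k l :=
        Finset.single_le_sum (fun l _ => hnn k l) (Finset.mem_univ l)
      have h2 : ∑ l, d k l ≤ ∑ k, ∑ l, d k l :=
        Finset.single_le_sum (f := fun k => ∑ l, d k l)
          (fun k _ => Finset.sum_nonneg fun l _ => hnn k l) (Finset.mem_univ k)
      linarith
  -- Any pair leaving `{i, j}` has sum at least `M`, which exceeds all distances; inside `{i, j}`
  -- only the loops compete, and these have distance zero.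
  let x : Fin n → ℝ := fun k => if k = i ∨ k = j then d i j / 2 else M
  have hij := hnn i j
  have key : ∀ k l, (s(k, l) = s(i, j) ∧ x k + x l = d k l) ∨ d k l < x k + x l := by
    intro k l
    have hkl := hM k l
    by_cases hk : k = i ∨ k = j <;> by_cases hl : l = i ∨ l = j
    · have hx : x k + x l = d i j := by simp [x, hk, hl]
      rw [hx]
      rcases eq_or_ne i j with rfl | hne
      · simp only [or_self] at hk hl
        subst hk; subst hl
        exact Or.inl ⟨rfl, rfl⟩
      · rcases hk with rfl | rfl <;> rcases hl with rfl | rfl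
        · exact Or.inr (by rw [hd.diag]; exact hd.pos _ _ hne)
        · exact Or.inl ⟨rfl, rfl⟩
        · exact Or.inl ⟨Sym2.eq_swap, hd.symm _ _⟩
        · exact Or.inr (by rw [hd.diag]; exact hd.pos _ _ hne)
    all_goals
      right
      simp only [x, hk, hl, if_true, if_false]
      linarith
  refine ⟨x, fun k l => ?_, ?_, fun k l h => ?_⟩
  · rcases key k l with h | h
    · exact h.2.ge
    · exact h.le
  · simp only [x, true_or, or_true, if_true]; ring
  · rcases key k l with h' | h'
    · exact h'.1
    · exact absurd h h'.ne'

/-- The polyhedron is nonempty and closed under adding nonnegative vectors, and these span the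
space. -/
theorem vectorSpan_metricPolyhedron (hd : IsMetric d) :
    vectorSpan ℝ (metricPolyhedron d) = ⊤ := by
  rw [eq_top_iff]
  rcases Nat.eq_zero_or_pos n with rfl | hn
  · intro u _
    rw [Subsingleton.elim u 0]
    exact zero_mem _
  obtain ⟨x, hx, -, -⟩ := exists_tightPairs_eq_singleton hd ⟨0, hn⟩ ⟨0, hn⟩
  have hmono : ∀ u : Fin n → ℝ, (∀ i, 0 ≤ u i) → x + u ∈ metricPolyhedron d := by
    intro u hu i j
    have := hx i j
    have h1 := hu i
    have h2 := hu j
    simp only [Pi.add_apply]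
    linarith
  have hpos : ∀ u : Fin n → ℝ, (∀ i, 0 ≤ u i) → u ∈ vectorSpan ℝ (metricPolyhedron d) := by
    intro u hu
    simpa using vsub_mem_vectorSpan ℝ (hmono u hu) hx
  intro u _
  have : u = (fun i => max (u i) 0) - fun i => max (-u i) 0 := by
    ext i
    rcases le_total (u i) 0 with h | h <;> simp [h]
  rw [this]
  exact Submodule.sub_mem _ (hpos _ fun i => le_max_right _ _) (hpos _ fun i => le_max_right _ _)

theorem finrank_vectorSpan_metricPolyhedron (hd : IsMetric d) :
    Module.finrank ℝ (vectorSpan ℝ (metricPolyhedron d)) = n := by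
  rw [vectorSpan_metricPolyhedron hd, finrank_top]
  simp

theorem vectorSpan_pairFace_le (hs : ∀ i j, d i j = d j i) (i j : Fin n) :
    vectorSpan ℝ (pairFace d s(i, j)) ≤
      LinearMap.ker (pairFunctional i j : (Fin n → ℝ) →ₗ[ℝ] ℝ) := by
  rw [vectorSpan_def, Submodule.span_le]
  rintro _ ⟨x, hx, y, hy, rfl⟩
  have h1 := (mk_mem_tightPairs hs).1 hx.2
  have h2 := (mk_mem_tightPairs hs).1 hy.2
  simp only [vsub_eq_sub, SetLike.mem_coe, LinearMap.mem_ker, ContinuousLinearMap.coe_coe,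
    map_sub, pairFunctional_apply]
  linarith

/-- At a point where only `p` is tight, every direction in the kernel of its functional can be
followed within the face, so the face spans a hyperplane. -/
theorem isFacet_pairFace (hd : IsMetric d) (p : Sym2 (Fin n)) :
    IsFacet (metricPolyhedron d) (pairFace d p) := by
  induction p with | _ i j
  obtain ⟨x, hx, hxt, hxs⟩ := exists_tightPairs_eq_singleton hd i j
  have hxF : x ∈ pairFace d s(i, j) := ⟨hx, (mk_mem_tightPairs hd.symm).2 hxt⟩
  refine ⟨fun _ => ⟨-pairFunctional i j, ?_⟩, ⟨x, hxF⟩, ?_⟩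
  · ext y
    simp only [pairFace, mk_mem_tightPairs hd.symm, Set.mem_ofPred_eq,
      neg_apply, pairFunctional_apply, neg_le_neg_iff]
    refine and_congr_right fun hy => ⟨fun h z hz => h ▸ hz i j, fun h => ?_⟩
    exact le_antisymm (hxt ▸ h x hx) (hy i j)
  · have : vectorSpan ℝ (pairFace d s(i, j)) =
        LinearMap.ker (pairFunctional i j : (Fin n → ℝ) →ₗ[ℝ] ℝ) := by
      refine le_antisymm (vectorSpan_pairFace_le hd.symm i j) fun u hu => ?_
      have hu' : u i + u j = 0 := hu
      obtain ⟨ε, hε, h⟩ := exists_pos_forall_add_smul_mem (u := u) hx fun k l hkl => by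
        rcases Sym2.eq_iff.1 (hxs k l hkl) with ⟨rfl, rfl⟩ | ⟨rfl, rfl⟩
        · exact hu'
        · rw [add_comm]; exact hu'
      have hmem : x + ε • u ∈ pairFace d s(i, j) := by
        refine ⟨h ε (abs_of_pos hε).le, (mk_mem_tightPairs hd.symm).2 ?_⟩
        simp only [Pi.add_apply, Pi.smul_apply, smul_eq_mul]
        linear_combination hxt + ε * hu'
      have := vsub_mem_vectorSpan ℝ hmem hxF
      rw [vsub_eq_sub, add_sub_cancel_left] at this
      exact (Submodule.smul_mem_iff _ hε.ne').1 this
    rw [this, finrank_vectorSpan_metricPolyhedron hd, finrank_ker_pairFunctional]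

theorem pairFace_injective (hd : IsMetric d) : Function.Injective (pairFace d) := by
  intro p q h
  induction p with | _ i j
  induction q with | _ k l
  obtain ⟨x, hx, hxt, hxs⟩ := exists_tightPairs_eq_singleton hd i j
  have hxF : x ∈ pairFace d s(i, j) := ⟨hx, (mk_mem_tightPairs hd.symm).2 hxt⟩
  rw [h] at hxF
  exact (hxs k l ((mk_mem_tightPairs hd.symm).1 hxF.2)).symm

/-- A proper exposed face is contained in one of the facets given by the pairs. -/
theorem exists_subset_pairFace {F : Set (Fin n → ℝ)} (hF : IsExposed ℝ (metricPolyhedron d) F)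
    (hne : F.Nonempty) (hprop : F ≠ metricPolyhedron d) :
    ∃ i j, F ⊆ pairFace d s(i, j) := by
  obtain ⟨l, hl⟩ := hF hne
  have hFP : F ⊆ metricPolyhedron d := hF.subset
  have hconv : Convex ℝ F := hF.convex convex_metricPolyhedron
  by_contra! hcon
  have hcon' : ∀ p : Fin n × Fin n, ∃ x ∈ F, d p.1 p.2 < x p.1 + x p.2 := by
    rintro ⟨i, j⟩
    obtain ⟨x, hxF, hx⟩ := Set.not_subset.1 (hcon i j)
    refine ⟨x, hxF, lt_of_le_of_ne (hFP hxF i j) fun h => hx ⟨hFP hxF, i, j, rfl, h.symm⟩⟩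
  choose f hfF hf using hcon'
  obtain ⟨w, hwF, hw⟩ : ∃ w ∈ F, ∀ i j, d i j < w i + w j := by
    rcases isEmpty_or_nonempty (Fin n) with hn | hn
    · obtain ⟨x, hx⟩ := hne
      exact ⟨x, hx, fun i => hn.elim i⟩
    -- The barycentre of points of `F`, one making each inequality strict, makes all of them strict.
    -- A functional maximal at such an interior point vanishes, so it exposes the whole polyhedron.
    let c : ℝ := (Fintype.card (Fin n × Fin n) : ℝ)⁻¹
    have hc : 0 < c := inv_pos.2 (by exact_mod_cast Fintype.card_pos)
    have hcs : ∑ _p : Fin n × Fin n, c = 1 := by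
      rw [Finset.sum_const, nsmul_eq_mul, Finset.card_univ]
      exact mul_inv_cancel₀ (by exact_mod_cast Fintype.card_ne_zero)
    refine ⟨∑ p, c • f p, hconv.sum_mem (fun _ _ => hc.le) hcs fun p _ => hfF p, fun i j => ?_⟩
    have h1 : (∑ p, c • f p) i + (∑ p, c • f p) j = ∑ p, c * (f p i + f p j) := by
      simp only [Finset.sum_apply, Pi.smul_apply, smul_eq_mul, mul_add, Finset.sum_add_distrib]
    have h2 : d i j = ∑ _p : Fin n × Fin n, c * d i j := by
      rw [← Finset.sum_mul, hcs, one_mul]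
    rw [h1, h2]
    refine Finset.sum_lt_sum (fun p _ => mul_le_mul_of_nonneg_left (hFP (hfF p) i j) hc.le)
      ⟨(i, j), Finset.mem_univ _, mul_lt_mul_of_pos_left (hf (i, j)) hc⟩
  have hmax : ∀ y ∈ metricPolyhedron d, l y ≤ l w := by
    rw [hl] at hwF; exact hwF.2
  have hl0 : ∀ u, l u ≤ 0 := by
    intro u
    obtain ⟨ε, hε, h⟩ := exists_pos_forall_add_smul_mem (u := u) (hFP hwF)
      fun i j hij => absurd hij (hw i j).ne'
    have := hmax _ (h ε (abs_of_pos hε).le)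
    rw [map_add, map_smul, smul_eq_mul] at this
    by_contra! hpos
    have := mul_pos hε hpos
    linarith
  have hl0' : ∀ u, l u = 0 := fun u =>
    le_antisymm (hl0 u) (by have := hl0 (-u); rw [map_neg] at this; linarith)
  apply hprop
  rw [hl]
  ext x
  simp [hl0']

/-- A facet lies in some `pairFace` and by dimension has the same direction space. The exposing
functional is constant along these directions, so the facet is the whole `pairFace`. -/
theorem exists_pairFace_eq_of_isFacet (hd : IsMetric d) {F : Set (Fin n → ℝ)}
    (hF : IsFacet (metricPolyhedron d) F) : ∃ p, F = pairFace d p := by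
  obtain ⟨hexp, hne, hdim⟩ := hF
  obtain ⟨i, j, hsub⟩ := exists_subset_pairFace hexp hne (by rintro rfl; omega)
  refine ⟨s(i, j), hsub.antisymm fun x hx => ?_⟩
  have hker : vectorSpan ℝ F = LinearMap.ker (pairFunctional i j : (Fin n → ℝ) →ₗ[ℝ] ℝ) := by
    apply Submodule.eq_of_le_of_finrank_eq
      ((vectorSpan_mono ℝ hsub).trans (vectorSpan_pairFace_le hd.symm i j))
    have := finrank_ker_pairFunctional i j
    rw [finrank_vectorSpan_metricPolyhedron hd] at hdim
    omega
  obtain ⟨y, hy⟩ := hne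
  obtain ⟨l, hl⟩ := hexp ⟨y, hy⟩
  have hxy : x - y ∈ vectorSpan ℝ F := by
    rw [hker]
    exact vectorSpan_pairFace_le hd.symm i j (vsub_mem_vectorSpan ℝ hx (hsub hy))
  have hlker : vectorSpan ℝ F ≤ LinearMap.ker (l : (Fin n → ℝ) →ₗ[ℝ] ℝ) := by
    rw [vectorSpan_def, Submodule.span_le]
    rintro _ ⟨a, ha, b, hb, rfl⟩
    rw [hl] at ha hb
    have h1 := ha.2 b hb.1
    have h2 := hb.2 a ha.1
    simp only [vsub_eq_sub, SetLike.mem_coe, LinearMap.mem_ker, ContinuousLinearMap.coe_coe,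
      map_sub]
    linarith
  have hlxy : l (x - y) = 0 := hlker hxy
  rw [map_sub, sub_eq_zero] at hlxy
  rw [hl] at hy ⊢
  exact ⟨hx.1, fun z hz => hlxy ▸ hy.2 z hz⟩

/-- The facets through a point correspond to the pairs that are tight there. -/
theorem encard_facets_eq (hd : IsMetric d) {v : Fin n → ℝ} (hv : v ∈ metricPolyhedron d) :
    {F : Set (Fin n → ℝ) | IsFacet (metricPolyhedron d) F ∧ v ∈ F}.encard =
      (tightPairs d v).encard := by
  rw [← (pairFace_injective hd).encard_image (tightPairs d v)]
  congr 1
  ext F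
  constructor
  · rintro ⟨hF, hvF⟩
    obtain ⟨p, rfl⟩ := exists_pairFace_eq_of_isFacet hd hF
    exact ⟨p, hvF.2, rfl⟩
  · rintro ⟨p, hp, rfl⟩
    exact ⟨isFacet_pairFace hd p, hv, hp⟩

/-- A set of pairs whose functionals have no common zero has at least `n` elements. -/
theorem le_encard_of_forall_eq_zero {S : Set (Sym2 (Fin n))}
    (hS : ∀ u : Fin n → ℝ, (∀ i j, s(i, j) ∈ S → u i + u j = 0) → u = 0) :
    (n : ℕ∞) ≤ S.encard := by
  classical
  -- The hypothesis makes evaluation of all pair sums injective, whence `n ≤ |S|`.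
  let f : (Fin n → ℝ) →ₗ[ℝ] (S → ℝ) :=
    LinearMap.pi fun p => (pairFunctional p.1.out.1 p.1.out.2 : (Fin n → ℝ) →ₗ[ℝ] ℝ)
  have hf : Function.Injective f := by
    rw [← LinearMap.ker_eq_bot, LinearMap.ker_eq_bot']
    refine fun u hu => hS u fun i j hij => ?_
    have h1 : u (s(i, j)).out.1 + u (s(i, j)).out.2 = 0 := congrFun hu ⟨s(i, j), hij⟩
    have h2 : s((s(i, j)).out.1, (s(i, j)).out.2) = s(i, j) := Quot.out_eq _
    rcases Sym2.eq_iff.1 h2 with ⟨h3, h4⟩ | ⟨h3, h4⟩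
    · rwa [h3, h4] at h1
    · rwa [h3, h4, add_comm] at h1
  have := LinearMap.finrank_le_finrank_of_injective hf
  rw [Module.finrank_fin_fun, Module.finrank_fintype_fun_eq_card] at this
  rw [Set.encard_eq_coe_toFinset_card, Set.toFinset_card]
  exact_mod_cast this

theorem eq_zero_of_mem_extremePoints {v : Fin n → ℝ}
    (hv : v ∈ (metricPolyhedron d).extremePoints ℝ) {u : Fin n → ℝ}
    (hu : ∀ i j, s(i, j) ∈ tightPairs d v → u i + u j = 0) : u = 0 := by
  obtain ⟨ε, hε, h⟩ := exists_pos_forall_add_smul_mem (u := u) hv.1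
    fun i j hij => hu i j ⟨i, j, rfl, hij⟩
  have h1 := h ε (abs_of_pos hε).le
  have h2 := h (-ε) (by rw [abs_neg, abs_of_pos hε])
  have h3 : v ∈ openSegment ℝ (v + ε • u) (v + (-ε) • u) := by
    refine ⟨1 / 2, 1 / 2, by norm_num, by norm_num, by norm_num, ?_⟩
    ext i
    simp only [Pi.add_apply, Pi.smul_apply, smul_eq_mul]
    ring
  have h4 := hv.2 h1 h2 h3
  simpa [hε.ne'] using h4

theorem mem_extremePoints_of_forall_eq_zero {v : Fin n → ℝ} (hv : v ∈ metricPolyhedron d)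
    (h0 : ∀ u : Fin n → ℝ, (∀ i j, s(i, j) ∈ tightPairs d v → u i + u j = 0) → u = 0)
    (hs : ∀ i j, d i j = d j i) :
    v ∈ (metricPolyhedron d).extremePoints ℝ := by
  refine ⟨hv, fun x hx y hy hxy => ?_⟩
  obtain ⟨a, b, ha, hb, hab, rfl⟩ := hxy
  have hxy : x - y = 0 := by
    refine h0 _ fun i j hij => ?_
    have h1 := (mk_mem_tightPairs hs).1 hij
    simp only [Pi.add_apply, Pi.smul_apply, smul_eq_mul, Pi.sub_apply] at h1 ⊢
    have h2 := hx i j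
    have h3 := hy i j
    have h4 : a * (x i + x j - d i j) + b * (y i + y j - d i j) = 0 := by
      linear_combination h1 - d i j * hab
    have h5 : 0 ≤ a * (x i + x j - d i j) := mul_nonneg ha.le (by linarith)
    have h6 : 0 ≤ b * (y i + y j - d i j) := mul_nonneg hb.le (by linarith)
    have h7 : a * (x i + x j - d i j) = 0 := by linarith
    have h8 : b * (y i + y j - d i j) = 0 := by linarith
    have h9 := (mul_eq_zero.1 h7).resolve_left ha.ne'
    have h10 := (mul_eq_zero.1 h8).resolve_left hb.ne'
    linarith
  rw [sub_eq_zero] at hxy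
  subst hxy
  rw [← add_smul, hab, one_smul]

/-- For a generic metric, a graph without common zeros whose edges are tight at a point of the
metric polyhedron is a cell. -/
theorem isCell_of_forall_eq_zero (hd : IsMetric d) (hgen : IsGeneric d) {Γ : SimpleGraph (Fin n)}
    {v : Fin n → ℝ} (hv : v ∈ metricPolyhedron d) (hΓ : ∀ i j, Γ.Adj i j → v i + v j = d i j)
    (h0 : ∀ u : Fin n → ℝ, (∀ i j, Γ.Adj i j → u i + u j = 0) → u = 0) :
    IsCell d Γ := by
  have hsub : Γ.edgeSet ⊆ tightPairs d v := by
    intro p hp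
    induction p with | _ i j
    exact ⟨i, j, rfl, hΓ i j hp⟩
  have hcard : (n : ℕ∞) ≤ Γ.edgeSet.encard := le_encard_of_forall_eq_zero h0
  have hext : v ∈ (metricPolyhedron d).extremePoints ℝ :=
    mem_extremePoints_of_forall_eq_zero hv
      (fun u hu => h0 u fun i j hij => hu i j (hsub hij)) hd.symm
  have htight : (tightPairs d v).encard = n := by
    rw [← encard_facets_eq hd hv, hgen v hext, finrank_vectorSpan_metricPolyhedron hd]
  have heq : Γ.edgeSet = tightPairs d v :=
    (Set.toFinite _).eq_of_subset_of_encard_le hsub (htight ▸ hcard)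
  refine ⟨v, fun i j _ => ⟨hΓ i j, fun hij => lt_of_le_of_ne (hv i j) fun h => hij ?_⟩⟩
  rw [← SimpleGraph.mem_edgeSet, heq]
  exact ⟨i, j, rfl, h.symm⟩

/-- Only the upper bound needs checking: the functionals tight at a vertex have no common zero, so
there are at least `n` of them. -/
theorem isGeneric_of_encard_tightPairs_le (hd : IsMetric d)
    (h : ∀ v ∈ metricPolyhedron d, (tightPairs d v).encard ≤ n) : IsGeneric d := by
  intro v hv
  rw [encard_facets_eq hd hv.1, finrank_vectorSpan_metricPolyhedron hd]
  exact le_antisymm (h v hv.1)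
    (le_encard_of_forall_eq_zero fun u hu => eq_zero_of_mem_extremePoints hv hu)

end Polyhedron

/-! ### Long diagonals of an odd polygon. -/

section OddPolygon

/-- The slack `s p q = x p + x q - D p q` in an odd cyclic order satisfying the exchange
inequalities is nonnegative once it vanishes on the long diagonals. -/
theorem nonneg_of_long_diagonals {m : ℕ} {s : ℕ → ℕ → ℝ}
    (h1 : ∀ a b c e, a ≤ b → b ≤ c → c ≤ e → e ≤ 2 * m → s a c + s b e ≤ s a b + s c e)
    (h2 : ∀ a b c e, a ≤ b → b ≤ c → c ≤ e → e ≤ 2 * m → s a c + s b e ≤ s a e + s b c)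
    (hz : ∀ i ≤ m, s i (i + m) = 0) (hz' : ∀ i < m, s i (i + m + 1) = 0)
    {p q : ℕ} (hpq : p ≤ q) (hq : q ≤ 2 * m) : 0 ≤ s p q := by
  -- In each of the four regions an exchange inequality is applied to four points for which two of
  -- the pairs are long diagonals. Their slacks vanish, leaving a comparison with a neighbouring
  -- pair closer to the base of the induction.
  have wide : ∀ p k, p + m + k ≤ 2 * m → 0 ≤ s p (p + m + k) := by
    intro p k
    induction k with
    | zero => intro h; exact (hz p (by omega)).ge
    | succ k ih =>
      intro h
      have h3 := h2 p (p + k) (p + m + k) (p + m + (k + 1)) (by omega) (by omega) (by omega) h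
      have h4 := hz (p + k) (by omega)
      have h5 := hz' (p + k) (by omega)
      rw [show p + k + m = p + m + k by omega] at h4
      rw [show p + k + m + 1 = p + m + (k + 1) by omega] at h5
      have := ih (by omega)
      linarith
  have middle : ∀ p q, q ≤ p + m → p ≤ m → m ≤ q → q ≤ 2 * m → 0 ≤ s p q := by
    intro p
    induction p with
    | zero =>
      intro q hq _ hq' _
      obtain rfl : q = 0 + m := by omega
      exact (hz 0 (by omega)).ge
    | succ p ih =>
      intro q hq hp hq' hq2
      rcases hq.eq_or_lt with rfl | hlt
      · exact (hz _ hp).ge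
      have h3 := h2 p (p + 1) q (p + m + 1) (by omega) (by omega) (by omega) (by omega)
      have h4 := hz (p + 1) hp
      have h5 := hz' p (by omega)
      rw [show p + 1 + m = p + m + 1 by omega] at h4
      have := ih q (by omega) (by omega) hq' hq2
      linarith
  have low : ∀ k p q, q + k = m → p ≤ q → 0 ≤ s p q := by
    intro k
    induction k with
    | zero =>
      intro p q hk hpq
      exact middle p q (by omega) (by omega) (by omega) (by omega)
    | succ k ih =>
      intro p q hk hpq
      have h3 := h1 p q (q + 1) (q + m + 1) hpq (by omega) (by omega) (by omega)
      have h4 := hz (q + 1) (by omega)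
      have h5 := hz' q (by omega)
      rw [show q + 1 + m = q + m + 1 by omega] at h4
      have := ih p (q + 1) (by omega) (by omega)
      linarith
  have high : ∀ k q, m + k ≤ q → q ≤ 2 * m → 0 ≤ s (m + k) q := by
    intro k
    induction k with
    | zero =>
      intro q hk hq
      exact middle m q (by omega) (by omega) (by omega) (by omega)
    | succ k ih =>
      intro q hk hq
      have h3 := h1 k (m + k) (m + (k + 1)) q (by omega) (by omega) hk hq
      have h4 := hz k (by omega)
      have h5 := hz' k (by omega)
      rw [show k + m = m + k by omega] at h4
      rw [show k + m + 1 = m + (k + 1) by omega] at h5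
      have := ih q (by omega) hq
      linarith
  rcases le_total q m with hqm | hqm
  · exact low (m - q) p q (by omega) hpq
  rcases le_total m p with hpm | hpm
  · obtain ⟨k, rfl⟩ := Nat.exists_eq_add_of_le hpm
    exact high k q hpq hq
  rcases le_total q (p + m) with h | h
  · exact middle p q h hpm hqm hq
  · obtain ⟨k, rfl⟩ := Nat.exists_eq_add_of_le h
    exact wide p k hq

/-- Heights that are tight on the long diagonals of an odd polygon. -/
theorem exists_tight_on_long_diagonals (m : ℕ) (D : ℕ → ℕ → ℝ) :
    ∃ x : ℕ → ℝ, (∀ i ≤ m, x i + x (i + m) = D i (i + m)) ∧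
      ∀ i < m, x i + x (i + m + 1) = D i (i + m + 1) := by
  let S : ℕ → ℝ := fun i => ∑ j ∈ Finset.range i, (D (j + 1) (j + 1 + m) - D j (j + m + 1))
  -- The diagonals from `i` and `i + 1` to `i + m + 1` force `x (i + 1) - x i`, hence the sums `S`.
  -- The diagonal `{0, m}` closes the odd cycle and gives `2 * x 0 = D 0 m - S m`.
  let L : ℕ → ℝ := fun i => (D 0 m - S m) / 2 + S i
  have hL : ∀ i, L (i + 1) = L i + (D (i + 1) (i + 1 + m) - D i (i + m + 1)) := fun i => by
    simp only [L, S, Finset.sum_range_succ]; ring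
  refine ⟨fun i => if i ≤ m then L i else D (i - (m + 1)) i - L (i - (m + 1)), ?_, ?_⟩
  · intro i hi
    rcases Nat.eq_zero_or_pos i with rfl | hpos
    · simp only [zero_add, Nat.zero_le, le_refl, if_true, L]
      simp only [S, Finset.range_zero, Finset.sum_empty]
      ring
    · obtain ⟨k, rfl⟩ := Nat.exists_eq_add_of_le' hpos
      have h3 : ¬ k + 1 + m ≤ m := by omega
      have h4 : k + 1 + m - (m + 1) = k := by omega
      simp only [hi, h3, h4, if_true, if_false, hL]
      rw [show k + 1 + m = k + m + 1 by omega]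
      ring
  · intro i hi
    have h3 : ¬ i + m + 1 ≤ m := by omega
    have h4 : i + m + 1 - (m + 1) = i := by omega
    simp only [hi.le, h3, h4, if_true, if_false]
    ring

theorem exists_dominating_tight_on_long_diagonals {m : ℕ} {D : ℕ → ℕ → ℝ}
    (h1 : ∀ a b c e, a ≤ b → b ≤ c → c ≤ e → e ≤ 2 * m → D a b + D c e ≤ D a c + D b e)
    (h2 : ∀ a b c e, a ≤ b → b ≤ c → c ≤ e → e ≤ 2 * m → D a e + D b c ≤ D a c + D b e) :
    ∃ x : ℕ → ℝ, (∀ i ≤ m, x i + x (i + m) = D i (i + m)) ∧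
      (∀ i < m, x i + x (i + m + 1) = D i (i + m + 1)) ∧
      ∀ p q, p ≤ q → q ≤ 2 * m → D p q ≤ x p + x q := by
  obtain ⟨x, hx, hx'⟩ := exists_tight_on_long_diagonals m D
  refine ⟨x, hx, hx', fun p q hpq hq => ?_⟩
  have := nonneg_of_long_diagonals (m := m) (s := fun p q => x p + x q - D p q)
    (fun a b c e hab hbc hce he => by have := h1 a b c e hab hbc hce he; linarith)
    (fun a b c e hab hbc hce he => by have := h2 a b c e hab hbc hce he; linarith)
    (fun i hi => sub_eq_zero.2 (hx i hi)) (fun i hi => sub_eq_zero.2 (hx' i hi)) hpq hq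
  linarith

/-- The sign changes along each diagonal, and the cycle of long diagonals is odd. -/
theorem eq_zero_of_long_diagonals {m : ℕ} {u : ℕ → ℝ}
    (hu : ∀ i ≤ m, u i + u (i + m) = 0) (hu' : ∀ i < m, u i + u (i + m + 1) = 0)
    {p : ℕ} (hp : p ≤ 2 * m) : u p = 0 := by
  have hconst : ∀ i ≤ m, u i = u 0 := by
    intro i
    induction i with
    | zero => intro _; rfl
    | succ i ih =>
      intro hi
      have h1 := hu (i + 1) hi
      have h2 := hu' i (by omega)
      rw [show i + 1 + m = i + m + 1 by omega] at h1
      have := ih (by omega)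
      linarith
  have h0 : u 0 = 0 := by
    have h1 := hu 0 (Nat.zero_le _)
    rw [zero_add, hconst m le_rfl] at h1
    linarith
  rcases le_total p m with h | h
  · rw [hconst p h, h0]
  · obtain ⟨k, rfl⟩ := Nat.exists_eq_add_of_le' h
    have := hu k (by omega)
    rw [hconst k (by omega), h0] at this
    linarith

end OddPolygon

/-! ### The two graphs as cells. -/

section Cycles

variable {n : ℕ} {d : Fin n → Fin n → ℝ}

theorem label_injective : Function.Injective (label : Fin n → ℕ) := fun _ _ h =>
  Fin.ext (Nat.succ_injective h)

/-- The order in which the cycle of the long diagonals visits the vertices of a polygon with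
`2 * m + 1` vertices. -/
def diagonalSeq (m t : ℕ) : ℕ := if t % 2 = 0 then t / 2 else m + 1 + t / 2

theorem diagonalSeq_step {m t : ℕ} (ht : t < 2 * m + 1) :
    (diagonalSeq m t < m ∧
        diagonalSeq m ((t + 1) % (2 * m + 1)) = diagonalSeq m t + m + 1) ∨
      (diagonalSeq m ((t + 1) % (2 * m + 1)) ≤ m ∧
        diagonalSeq m t = diagonalSeq m ((t + 1) % (2 * m + 1)) + m) := by
  rcases Nat.lt_or_ge (t + 1) (2 * m + 1) with h | h
  · rw [Nat.mod_eq_of_lt h]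
    unfold diagonalSeq
    split_ifs <;> omega
  · obtain rfl : t = 2 * m := by omega
    rw [Nat.mod_self]
    unfold diagonalSeq
    split_ifs <;> omega

/-- `p < q` are the end points of a long diagonal of a polygon with `2 * m + 1` vertices. -/
def IsLongDiagonal (m p q : ℕ) : Prop := (p ≤ m ∧ q = p + m) ∨ (p < m ∧ q = p + m + 1)

theorem IsLongDiagonal.exists_diagonalSeq {m p q : ℕ} (h : IsLongDiagonal m p q) :
    ∃ t < 2 * m + 1,
      (diagonalSeq m t = p ∧ diagonalSeq m ((t + 1) % (2 * m + 1)) = q) ∨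
      (diagonalSeq m t = q ∧ diagonalSeq m ((t + 1) % (2 * m + 1)) = p) := by
  rcases h with ⟨hp, rfl⟩ | ⟨hp, rfl⟩
  · rcases Nat.eq_zero_or_pos p with rfl | hpos
    · refine ⟨2 * m, by omega, Or.inr ?_⟩
      rw [Nat.mod_self]
      unfold diagonalSeq
      split_ifs <;> omega
    · refine ⟨2 * p - 1, by omega, Or.inr ?_⟩
      rw [Nat.mod_eq_of_lt (by omega)]
      unfold diagonalSeq
      split_ifs <;> omega
  · refine ⟨2 * p, by omega, Or.inl ?_⟩
    rw [Nat.mod_eq_of_lt (by omega)]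
    unfold diagonalSeq
    split_ifs <;> omega

theorem exists_isLongDiagonal_of_adj {m : ℕ} {c : ℕ → ℕ} {e : ℕ → Fin n}
    (hc : ∀ t < 2 * m + 1, c t = label (e (diagonalSeq m t))) {i j : Fin n}
    (h : (closedWalkGraph n (2 * m + 1) c).Adj i j) :
    ∃ p q, IsLongDiagonal m p q ∧ ((i = e p ∧ j = e q) ∨ (i = e q ∧ j = e p)) := by
  have key : ∀ i j : Fin n, (∃ t < 2 * m + 1, label i = c t ∧
      label j = c ((t + 1) % (2 * m + 1))) →
      ∃ p q, IsLongDiagonal m p q ∧ ((i = e p ∧ j = e q) ∨ (i = e q ∧ j = e p)) := by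
    rintro i j ⟨t, ht, hi, hj⟩
    rw [hc t ht] at hi
    rw [hc _ (Nat.mod_lt _ (by omega))] at hj
    have hi' := label_injective hi
    have hj' := label_injective hj
    rcases diagonalSeq_step ht with h | h
    · exact ⟨_, _, Or.inr h, Or.inl ⟨hi', hj'⟩⟩
    · exact ⟨_, _, Or.inl h, Or.inr ⟨hi', hj'⟩⟩
  rcases ((SimpleGraph.fromRel_adj _ _ _).1 h).2 with h | h
  · exact key i j h
  · obtain ⟨p, q, hpq, h⟩ := key j i h
    exact ⟨p, q, hpq, h.symm.imp And.symm And.symm⟩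

theorem IsLongDiagonal.adj {m : ℕ} {c : ℕ → ℕ} {e : ℕ → Fin n}
    (hc : ∀ t < 2 * m + 1, c t = label (e (diagonalSeq m t))) {p q : ℕ}
    (h : IsLongDiagonal m p q) (hne : e p ≠ e q) :
    (closedWalkGraph n (2 * m + 1) c).Adj (e p) (e q) := by
  refine (SimpleGraph.fromRel_adj _ _ _).2 ⟨hne, ?_⟩
  obtain ⟨t, ht, ⟨rfl, rfl⟩ | ⟨rfl, rfl⟩⟩ := h.exists_diagonalSeq
  · exact Or.inl ⟨t, ht, (hc t ht).symm, (hc _ (Nat.mod_lt _ (by omega))).symm⟩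
  · exact Or.inr ⟨t, ht, (hc t ht).symm, (hc _ (Nat.mod_lt _ (by omega))).symm⟩

/-- An order-preserving family of `2 * m + 1` points has dominating heights that are tight on its
long diagonals. -/
theorem ExchangeInequalities.exists_heights (hex : ExchangeInequalities d)
    (hs : ∀ i j, d i j = d j i) (m : ℕ) {e : ℕ → Fin n} (he : Monotone e) :
    ∃ x : ℕ → ℝ, (∀ p q, IsLongDiagonal m p q → x p + x q = d (e p) (e q)) ∧
      ∀ p q, p ≤ 2 * m → q ≤ 2 * m → d (e p) (e q) ≤ x p + x q := by
  obtain ⟨x, hx, hx', hle⟩ := exists_dominating_tight_on_long_diagonals (m := m)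
    (D := fun p q => d (e p) (e q))
    (fun a b c f hab hbc hcf _ => by
      have := (hex (e a) (e b) (e c) (e f) (he hab) (he hbc) (he hcf)).1
      linarith)
    (fun a b c f hab hbc hcf _ => by
      have := (hex (e a) (e b) (e c) (e f) (he hab) (he hbc) (he hcf)).2
      linarith)
  refine ⟨x, ?_, fun p q hp hq => ?_⟩
  · rintro p q (⟨hp, rfl⟩ | ⟨hp, rfl⟩)
    · exact hx p hp
    · exact hx' p hp
  · rcases le_total p q with h | h
    · exact hle p q h hq
    · rw [hs, add_comm]; exact hle q p h hp

theorem eq_zero_of_isLongDiagonal {m : ℕ} {u : ℕ → ℝ}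
    (hu : ∀ p q, IsLongDiagonal m p q → u p + u q = 0) {p : ℕ} (hp : p ≤ 2 * m) : u p = 0 :=
  eq_zero_of_long_diagonals (fun _ hi => hu _ _ (Or.inl ⟨hi, rfl⟩))
    (fun _ hi => hu _ _ (Or.inr ⟨hi, rfl⟩)) hp

theorem isCell_oddCycle (hn : 3 ≤ n) (hd : IsMetric d) (hgen : IsGeneric d)
    (hex : ExchangeInequalities d) (hodd : Odd n) : IsCell d (oddCycle n) := by
  obtain ⟨m, rfl⟩ := hodd
  let e : ℕ → Fin (2 * m + 1) := fun p => ⟨min p (2 * m), by omega⟩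
  have he : Monotone e := fun _ _ h => Fin.mk_le_mk.2 (min_le_min_right _ h)
  have hei : ∀ i : Fin (2 * m + 1), e i = i := fun i => Fin.ext (by simp only [e]; omega)
  have hc : ∀ t < 2 * m + 1, oddSeq (2 * m + 1) t = label (e (diagonalSeq m t)) := by
    intro t ht
    simp only [oddSeq, label, e, diagonalSeq]
    split_ifs <;> omega
  obtain ⟨x, hx, hle⟩ := hex.exists_heights hd.symm m he
  refine isCell_of_forall_eq_zero hd hgen (v := fun i => x i) ?_ ?_ ?_
  · intro i j
    have := hle i j (by omega) (by omega)
    rwa [hei, hei] at this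
  · intro i j hij
    obtain ⟨p, q, hpq, h⟩ := exists_isLongDiagonal_of_adj hc hij
    have hxpq := hx p q hpq
    have hpv : ((e p : Fin _) : ℕ) = p := by
      simp only [e]; rcases hpq with h | h <;> omega
    have hqv : ((e q : Fin _) : ℕ) = q := by
      simp only [e]; rcases hpq with h | h <;> omega
    rcases h with ⟨rfl, rfl⟩ | ⟨rfl, rfl⟩
    · simp only [hpv, hqv, hxpq]
    · simp only [hpv, hqv]
      rw [hd.symm, add_comm, hxpq]
  · intro u hu
    ext i
    rw [← hei i]
    refine eq_zero_of_isLongDiagonal (m := m) (u := fun p => u (e p)) (fun p q hpq => ?_) (by omega)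
    refine hu _ _ (hpq.adj hc fun h => ?_)
    have := congrArg Fin.val h
    simp only [e] at this
    rcases hpq with h | h <;> omega

theorem isCell_evenCycleWithEdge (hn : 3 ≤ n) (hd : IsMetric d) (hgen : IsGeneric d)
    (hex : ExchangeInequalities d) (heven : Even n) : IsCell d (evenCycleWithEdge n) := by
  obtain ⟨m, rfl⟩ : ∃ m, n = 2 * m + 2 := by
    obtain ⟨k, rfl⟩ := heven
    exact ⟨k - 1, by omega⟩
  -- The polygon has the vertices other than `z`, whose index `m + 1` is label `n / 2 + 1`; `g`
  -- skips it and `r` inverts this. The `min` only keeps `g` in range beyond `2 * m`.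
  let g : ℕ → ℕ := fun p => if p ≤ m then p else min (p + 1) (2 * m + 1)
  have hgb : ∀ p, g p < 2 * m + 2 := fun p => by simp only [g]; split_ifs <;> omega
  let e : ℕ → Fin (2 * m + 2) := fun p => ⟨g p, hgb p⟩
  have he : Monotone e := fun p q h => Fin.mk_le_mk.2 (by
    simp only [g]; split_ifs <;> omega)
  let r : Fin (2 * m + 2) → ℕ := fun i => if (i : ℕ) ≤ m then i else i - 1
  have hr : ∀ i, r i ≤ 2 * m := fun i => by simp only [r]; split_ifs <;> omega
  let z : Fin (2 * m + 2) := ⟨m + 1, by omega⟩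
  have hei : ∀ i, i ≠ z → e (r i) = i := by
    intro i hi
    have : (i : ℕ) ≠ m + 1 := fun h => hi (Fin.ext h)
    refine Fin.ext ?_
    simp only [e, g, r]
    split_ifs <;> omega
  have hre : ∀ p ≤ 2 * m, r (e p) = p ∧ e p ≠ z := by
    intro p hp
    refine ⟨?_, fun h => ?_⟩
    · simp only [e, g, r]; split_ifs <;> omega
    · have := congrArg Fin.val h
      simp only [e, g, z] at this
      split_ifs at this <;> omega
  have hdiag : ∀ p q, IsLongDiagonal m p q → p ≤ 2 * m ∧ q ≤ 2 * m ∧ p ≠ q := by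
    rintro p q (h | h) <;> omega
  have hc : ∀ t < 2 * m + 1, evenSeq (2 * m + 2) t = label (e (diagonalSeq m t)) := by
    intro t ht
    simp only [evenSeq, label, e, g, diagonalSeq]
    split_ifs <;> omega
  obtain ⟨x, hx, hle⟩ := hex.exists_heights hd.symm m he
  let o : Fin (2 * m + 2) := ⟨0, by omega⟩
  have hoz : o ≠ z := fun h => by simp [o, z, Fin.ext_iff] at h
  -- The value at `z` is forced by tightness of the pendant edge `{o, z}`.
  let v : Fin (2 * m + 2) → ℝ := fun i => if i = z then d o z - x 0 else x (r i)
  have hvz : v z = d o z - x 0 := if_pos rfl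
  have hve : ∀ i, i ≠ z → v i = x (r i) := fun i hi => if_neg hi
  have hvdiag : ∀ p q, IsLongDiagonal m p q → v (e p) + v (e q) = d (e p) (e q) := by
    intro p q hpq
    obtain ⟨hp, hq, -⟩ := hdiag p q hpq
    rw [hve _ (hre p hp).2, hve _ (hre q hq).2, (hre p hp).1, (hre q hq).1, hx p q hpq]
  have hlev : ∀ i j, i ≠ z → j ≠ z → d i j ≤ v i + v j := by
    intro i j hi hj
    rw [hve i hi, hve j hj]
    have := hle (r i) (r j) (hr i) (hr j)
    rwa [hei i hi, hei j hj] at this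
  have hro : r o = 0 := by simp [r, o]
  have hsoz : v o + v z = d o z := by
    rw [hvz, hve o hoz, hro]; ring
  -- The neighbours `a` and `w` of `o` on the cycle flank `z`. Exchange with `o` and `w`, or `o` and
  -- `a`, bounds the slack of `{q, z}` below by that of `{q, w}` or `{a, q}`, since the edges at `o`
  -- are tight.
  obtain ⟨a, ha, hsa⟩ : ∃ a : Fin (2 * m + 2), (a : ℕ) = m ∧ v o + v a = d o a := by
    have := hvdiag 0 m (Or.inl ⟨by omega, by omega⟩)
    have h0 : e 0 = o := by simp [e, g, o]
    exact ⟨e m, by simp [e, g], by rwa [h0] at this⟩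
  obtain ⟨w, hw, hsw⟩ : ∃ w : Fin (2 * m + 2), (w : ℕ) = m + 2 ∧ v o + v w = d o w := by
    have := hvdiag 0 (m + 1) (Or.inr ⟨by omega, by omega⟩)
    have h0 : e 0 = o := by simp [e, g, o]
    refine ⟨e (m + 1), ?_, by rwa [h0] at this⟩
    simp only [e, g]; split_ifs <;> omega
  have hwz : w ≠ z := fun h => by have := congrArg Fin.val h; simp only [hw, z] at this; omega
  have haz : a ≠ z := fun h => by have := congrArg Fin.val h; simp only [ha, z] at this; omega
  have hlez : ∀ q, q ≠ z → d q z ≤ v q + v z := by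
    intro q hq
    rcases Nat.lt_or_ge (q : ℕ) (m + 1) with h | h
    · have h1 := (hex o q z w (Fin.mk_le_of_le_val (Nat.zero_le _))
        (Fin.le_def.2 h.le) (Fin.le_def.2 (by simp only [z, hw]; omega))).2
      have h2 := hlev q w hq hwz
      linarith
    · have h1 := (hex o a z q (Fin.mk_le_of_le_val (Nat.zero_le _))
        (Fin.le_def.2 (by simp only [z, ha]; omega)) (Fin.le_def.2 h)).1
      have h2 := hlev a q haz hq
      rw [hd.symm q z]
      linarith
  have hlezz : d z z ≤ v z + v z := by
    have h1 := (hex o a z z (Fin.mk_le_of_le_val (Nat.zero_le _))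
        (Fin.le_def.2 (by simp only [z, ha]; omega)) le_rfl).1
    have h2 := hlez a haz
    linarith
  refine isCell_of_forall_eq_zero hd hgen (v := v) ?_ ?_ ?_
  · intro i j
    by_cases hi : i = z
    · by_cases hj : j = z
      · rw [hi, hj]; exact hlezz
      · rw [hi, hd.symm, add_comm]; exact hlez j hj
    · by_cases hj : j = z
      · rw [hj]; exact hlez i hi
      · exact hlev i j hi hj
  · intro i j hij
    rcases hij with hij | hij
    · obtain ⟨p, q, hpq, ⟨rfl, rfl⟩ | ⟨rfl, rfl⟩⟩ := exists_isLongDiagonal_of_adj hc hij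
      · exact hvdiag p q hpq
      · rw [hd.symm, add_comm]; exact hvdiag p q hpq
    · have key : ∀ i j : Fin (2 * m + 2), label i = 1 ∧ label j = (2 * m + 2) / 2 + 1 →
          i = o ∧ j = z := by
        rintro i j ⟨h1, h2⟩
        simp only [label] at h1 h2
        exact ⟨Fin.ext (by simp only [o]; omega), Fin.ext (by simp only [z]; omega)⟩
      rcases ((SimpleGraph.fromRel_adj _ _ _).1 hij).2 with h | h
      · obtain ⟨rfl, rfl⟩ := key i j h
        exact hsoz
      · obtain ⟨rfl, rfl⟩ := key j i h
        rw [hd.symm, add_comm]; exact hsoz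
  · intro u hu
    have hcyc : ∀ i, i ≠ z → u i = 0 := by
      intro i hi
      rw [← hei i hi]
      refine eq_zero_of_isLongDiagonal (m := m) (u := fun p => u (e p)) (fun p q hpq => ?_) (hr i)
      refine hu _ _ (Or.inl (hpq.adj hc fun h => ?_))
      obtain ⟨hp, hq, hne⟩ := hdiag p q hpq
      exact hne (by rw [← (hre p hp).1, ← (hre q hq).1, h])
    ext i
    by_cases hi : i = z
    · have h1 := hu o z (Or.inr ((SimpleGraph.fromRel_adj _ _ _).2 ⟨hoz, Or.inl ⟨rfl, ?_⟩⟩))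
      · rw [hcyc o hoz, zero_add] at h1
        rw [hi]; exact h1
      · simp only [label, z]; omega
    · exact hcyc i hi

end Cycles

/-! ### Genericity and exchange inequalities for `dMax`. -/

section DMax

variable {n : ℕ}

/-- If crossing pairings are strictly longest, then two disjoint pairs with the same sum modulo `n`
do not cross, so some other pairing of their four points is longer. -/
theorem add_lt_max_of_add_modEq {d : Fin n → Fin n → ℝ} (hs : ∀ i j, d i j = d j i)
    (h1 : ∀ i j k l, i < j → j < k → k < l → d i j + d k l < d i k + d j l)
    (h2 : ∀ i j k l, i < j → j < k → k < l → d i l + d j k < d i k + d j l)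
    {i j k l : Fin n} (hij : i < j) (hkl : k < l) (hik : i < k) (hjk : j ≠ k) (hjl : j ≠ l)
    (hmod : (i : ℕ) + j ≡ k + l [MOD n]) :
    d i j + d k l < max (d i k + d j l) (d i l + d j k) := by
  rcases lt_or_gt_of_ne hjk with hjk | hjk
  · exact lt_max_of_lt_left (h1 i j k l hij hjk hkl)
  rcases lt_or_gt_of_ne hjl with hjl | hjl
  -- Here the pairs cross, `i < k < j < l`, so `0 < (k + l) - (i + j) < n`, contradicting the
  -- congruence.
  · exfalso
    have h3 : (i : ℕ) + j < k + l := by omega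
    have h4 := (Nat.modEq_iff_dvd' h3.le).1 hmod
    have h5 := Nat.le_of_dvd (by omega) h4
    omega
  · refine lt_max_of_lt_right ?_
    have := h2 i k l j hik hkl hjl
    rw [hs j k]
    exact this

/-- If crossing pairings are strictly longest and all triangle inequalities are strict, then at most
`n` pairs are tight at a point of the metric polyhedron. -/
theorem encard_tightPairs_le {d : Fin n → Fin n → ℝ} (hd : IsMetric d)
    (ht : ∀ i j k, i ≠ j → j ≠ k → i ≠ k → d i k < d i j + d j k)
    (h1 : ∀ i j k l, i < j → j < k → k < l → d i j + d k l < d i k + d j l)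
    (h2 : ∀ i j k l, i < j → j < k → k < l → d i l + d j k < d i k + d j l)
    {v : Fin n → ℝ} (hv : v ∈ metricPolyhedron d) : (tightPairs d v).encard ≤ n := by
  rcases Nat.eq_zero_or_pos n with rfl | hn
  · have : tightPairs d v = ∅ := by
      ext p
      induction p with | _ i j
      exact i.elim0
    simp [this]
  -- A tight loop at `i` means `v i = 0`, so `v k ≥ d k i` and `v l ≥ d i l`; strictness of the
  -- triangle inequality, or positivity if `k = l`, excludes a tight pair avoiding `i`.
  have hloop : ∀ i k l, k ≠ i → l ≠ i → v i + v i = d i i → v k + v l ≠ d k l := by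
    intro i k l hk hl hi hkl
    rw [hd.diag] at hi
    have h3 := hv k i
    have h4 := hv i l
    rcases eq_or_ne k l with rfl | hne
    · have := hd.pos k i hk
      rw [hd.diag] at hkl
      linarith
    · have := ht k i l hk hl.symm hne
      linarith
  have hmain : ∀ i j k l, i < j → k < l → i < k → j ≠ k → j ≠ l →
      v i + v j = d i j → v k + v l = d k l → ¬ (i : ℕ) + j ≡ k + l [MOD n] := by
    intro i j k l hij hkl hik hjk hjl htij htkl hmod
    rcases lt_max_iff.1 (add_lt_max_of_add_modEq hd.symm h1 h2 hij hkl hik hjk hjl hmod) with h | h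
    · have := hv i k
      have := hv j l
      linarith
    · have := hv i l
      have := hv j k
      linarith
  have hcancel : ∀ i j k : Fin n, (i : ℕ) + j ≡ i + k [MOD n] → j = k := fun i j k h =>
    Fin.ext (Nat.ModEq.eq_of_lt_of_lt (Nat.ModEq.add_left_cancel' _ h) j.2 k.2)
  have hord : ∀ p ∈ tightPairs d v, ∃ i j, i ≤ j ∧ s(i, j) = p ∧ v i + v j = d i j := by
    rintro p ⟨i, j, rfl, h⟩
    rcases le_total i j with hij | hij
    · exact ⟨i, j, hij, rfl, h⟩
    · exact ⟨j, i, hij, Sym2.eq_swap, by rw [hd.symm, add_comm]; exact h⟩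
  -- Pairs with equal residue that share a point coincide, so only disjoint pairs must be excluded.
  let f : Sym2 (Fin n) → ℕ := Sym2.lift ⟨fun i j => ((i : ℕ) + j) % n, fun i j =>
    congrArg (· % n) (add_comm (i : ℕ) j)⟩
  have hf : Set.InjOn f (tightPairs d v) := by
    intro p hp q hq hpq
    obtain ⟨i, j, hij, rfl, htij⟩ := hord p hp
    obtain ⟨k, l, hkl, rfl, htkl⟩ := hord q hq
    have hmod : (i : ℕ) + j ≡ k + l [MOD n] := hpq
    by_cases hik : i = k
    · subst hik
      rw [hcancel _ _ _ hmod]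
    by_cases hjl : j = l
    · subst hjl
      rw [add_comm (i : ℕ), add_comm (k : ℕ)] at hmod
      rw [hcancel _ _ _ hmod]
    by_cases hil : i = l
    · subst hil
      rw [add_comm (k : ℕ)] at hmod
      rw [hcancel _ _ _ hmod, Sym2.eq_swap]
    by_cases hjk : j = k
    · subst hjk
      rw [add_comm (i : ℕ)] at hmod
      rw [hcancel _ _ _ hmod, Sym2.eq_swap]
    exfalso
    rcases hij.eq_or_lt with rfl | hij
    · exact hloop i k l (Ne.symm hik) (Ne.symm hil) htij htkl
    rcases hkl.eq_or_lt with rfl | hkl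
    · exact hloop k i j hik hjk htkl htij
    rcases lt_or_gt_of_ne hik with h | h
    · exact hmain i j k l hij hkl h hjk hjl htij htkl hmod
    · exact hmain k l i j hkl hij h (Ne.symm hil) (Ne.symm hjl) htkl htij hmod.symm
  calc (tightPairs d v).encard = (f '' tightPairs d v).encard := (hf.encard_image).symm
    _ ≤ (Set.Iio n).encard := by
        refine Set.encard_le_encard ?_
        rintro _ ⟨p, -, rfl⟩
        induction p with | _ i j
        exact Nat.mod_lt _ hn
    _ = n := by
        rw [← Finset.coe_Iio, Set.encard_coe_eq_coe_finsetCard, Nat.card_Iio]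

theorem dMax_symm (i j : Fin n) : dMax n i j = dMax n j i := by
  simp only [dMax, eq_comm (a := i) (b := j), min_comm i j, max_comm i j]

theorem dMax_of_lt {i j : Fin n} (h : i < j) :
    dMax n i j = 1 + 1 / ((n : ℝ) ^ 2 + ((i : ℝ) + 1) * n + ((j : ℝ) + 1)) := by
  rw [dMax, if_neg h.ne, min_eq_left h.le, max_eq_right h.le]
  simp [label]

theorem dMax_bounds {i j : Fin n} (h : i ≠ j) : 1 < dMax n i j ∧ dMax n i j < 2 := by
  wlog hij : i < j generalizing i j
  · rw [dMax_symm]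
    exact this h.symm (lt_of_le_of_ne (not_lt.1 hij) h.symm)
  rw [dMax_of_lt hij]
  have hi : (0 : ℝ) ≤ i := Nat.cast_nonneg _
  have hj : (0 : ℝ) < j := Nat.cast_pos.2 (by have := Fin.lt_def.1 hij; omega)
  have h1 : 1 < (n : ℝ) ^ 2 + ((i : ℝ) + 1) * n + ((j : ℝ) + 1) := by
    have : 0 ≤ (n : ℝ) ^ 2 + ((i : ℝ) + 1) * n := by positivity
    linarith
  have h2 : 0 < 1 / ((n : ℝ) ^ 2 + ((i : ℝ) + 1) * n + ((j : ℝ) + 1)) := by positivity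
  have h3 : 1 / ((n : ℝ) ^ 2 + ((i : ℝ) + 1) * n + ((j : ℝ) + 1)) < 1 := by
    rw [div_lt_one (by linarith)]
    exact h1
  constructor <;> linarith

theorem dMax_self (i : Fin n) : dMax n i i = 0 := if_pos rfl

theorem dMax_triangle_lt {i j k : Fin n} (hij : i ≠ j) (hjk : j ≠ k) :
    dMax n i k < dMax n i j + dMax n j k := by
  have h1 := dMax_bounds hij
  have h2 := dMax_bounds hjk
  rcases eq_or_ne i k with rfl | hik
  · rw [dMax_self]; linarith
  · have := dMax_bounds hik
    linarith

theorem isMetric_dMax (n : ℕ) : IsMetric (dMax n) where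
  diag := dMax_self
  symm := dMax_symm
  pos i j h := one_pos.trans (dMax_bounds h).1
  triangle i j k := by
    rcases eq_or_ne i j with rfl | hij
    · rw [dMax_self, zero_add]
    rcases eq_or_ne j k with rfl | hjk
    · rw [dMax_self, add_zero]
    exact (dMax_triangle_lt hij hjk).le

/-- With `c - b` the gap between the middle points, the two differences of reciprocals are at most
`(c - b) / N ^ 4` and more than `(c - b) * N / (4 * N ^ 4)`, so `N ≥ 4` suffices. -/
theorem dMax_crossing_left (hn : 4 ≤ n) {i j k l : Fin n} (hij : i < j) (hjk : j < k)
    (hkl : k < l) : dMax n i j + dMax n k l < dMax n i k + dMax n j l := by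
  rw [dMax_of_lt hij, dMax_of_lt hkl, dMax_of_lt (hij.trans hjk), dMax_of_lt (hjk.trans hkl)]
  have hN : (4 : ℝ) ≤ n := by exact_mod_cast hn
  have hi : (0 : ℝ) ≤ i := Nat.cast_nonneg _
  have hij' : (i : ℝ) < j := by exact_mod_cast hij
  have hjk' : (j : ℝ) < k := by exact_mod_cast hjk
  have hkl' : (k : ℝ) + 1 ≤ l := by exact_mod_cast hkl
  have hl : (l : ℝ) + 1 ≤ n := by exact_mod_cast l.2
  generalize (n : ℝ) = N at *
  generalize (i : ℝ) = a at *
  generalize (j : ℝ) = b at *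
  generalize (k : ℝ) = c at *
  generalize (l : ℝ) = e at *
  have hA : N ^ 2 ≤ N ^ 2 + (a + 1) * N + (b + 1) := by nlinarith
  have hB : N ^ 2 ≤ N ^ 2 + (a + 1) * N + (c + 1) := by nlinarith
  have hC : N ^ 2 + (b + 1) * N + (e + 1) < 2 * N ^ 2 := by nlinarith
  have hD : N ^ 2 + (c + 1) * N + (e + 1) ≤ 2 * N ^ 2 := by nlinarith
  have hC0 : 0 < N ^ 2 + (b + 1) * N + (e + 1) := by
    have : 0 ≤ b := by linarith
    have : 0 ≤ e := by linarith
    positivity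
  have hD0 : 0 < N ^ 2 + (c + 1) * N + (e + 1) := by
    have : 0 ≤ c := by linarith
    have : 0 ≤ e := by linarith
    positivity
  have hN2 : 0 < N ^ 2 := by positivity
  have e1 : 1 / (N ^ 2 + (a + 1) * N + (b + 1)) - 1 / (N ^ 2 + (a + 1) * N + (c + 1)) =
      (c - b) / ((N ^ 2 + (a + 1) * N + (b + 1)) * (N ^ 2 + (a + 1) * N + (c + 1))) := by
    rw [div_sub_div _ _ (hN2.trans_le hA).ne' (hN2.trans_le hB).ne']
    congr 1
    ring
  have e2 : 1 / (N ^ 2 + (b + 1) * N + (e + 1)) - 1 / (N ^ 2 + (c + 1) * N + (e + 1)) =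
      ((c - b) * N) / ((N ^ 2 + (b + 1) * N + (e + 1)) * (N ^ 2 + (c + 1) * N + (e + 1))) := by
    rw [div_sub_div _ _ hC0.ne' hD0.ne']
    congr 1
    ring
  have hcb : 0 < c - b := by linarith
  have h3 : (N ^ 2 + (b + 1) * N + (e + 1)) * (N ^ 2 + (c + 1) * N + (e + 1)) <
      4 * (N ^ 2 * N ^ 2) := by
    have := mul_lt_mul hC hD hD0 (by positivity : (0 : ℝ) ≤ 2 * N ^ 2)
    linarith
  have h4 : N ^ 2 * N ^ 2 ≤
      (N ^ 2 + (a + 1) * N + (b + 1)) * (N ^ 2 + (a + 1) * N + (c + 1)) :=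
    mul_le_mul hA hB hN2.le (hN2.le.trans hA)
  have h5 : (c - b) / ((N ^ 2 + (a + 1) * N + (b + 1)) * (N ^ 2 + (a + 1) * N + (c + 1))) ≤
      (c - b) / (N ^ 2 * N ^ 2) := div_le_div_of_nonneg_left hcb.le (by positivity) h4
  have h6 : (c - b) / (N ^ 2 * N ^ 2) <
      ((c - b) * N) / ((N ^ 2 + (b + 1) * N + (e + 1)) * (N ^ 2 + (c + 1) * N + (e + 1))) := by
    rw [div_lt_div_iff₀ (by positivity) (by positivity), mul_assoc]
    refine mul_lt_mul_of_pos_left (h3.trans_le ?_) hcb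
    exact mul_le_mul_of_nonneg_right hN (by positivity)
  linarith

/-- Replacing `k` by `l` lowers the reciprocal by `l - k` over a product of denominators that grows
with the first index, so the loss is smaller at `j` than at `i`. -/
theorem dMax_crossing_right {i j k l : Fin n} (hij : i < j) (hjk : j < k)
    (hkl : k < l) : dMax n i l + dMax n j k < dMax n i k + dMax n j l := by
  rw [dMax_of_lt ((hij.trans hjk).trans hkl), dMax_of_lt hjk, dMax_of_lt (hij.trans hjk),
    dMax_of_lt (hjk.trans hkl)]
  have hi : (0 : ℝ) ≤ i := Nat.cast_nonneg _
  have hij' : (i : ℝ) < j := by exact_mod_cast hij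
  have hjk' : (j : ℝ) < k := by exact_mod_cast hjk
  have hkl' : (k : ℝ) < l := by exact_mod_cast hkl
  have hN : (0 : ℝ) < n := Nat.cast_pos.2 i.pos
  generalize (n : ℝ) = N at *
  generalize (i : ℝ) = a at *
  generalize (j : ℝ) = b at *
  generalize (k : ℝ) = c at *
  generalize (l : ℝ) = e at *
  have hb : 0 ≤ b := by linarith
  have hc : 0 ≤ c := by linarith
  have he : 0 ≤ e := by linarith
  have e1 : 1 / (N ^ 2 + (a + 1) * N + (c + 1)) - 1 / (N ^ 2 + (a + 1) * N + (e + 1)) =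
      (e - c) / ((N ^ 2 + (a + 1) * N + (c + 1)) * (N ^ 2 + (a + 1) * N + (e + 1))) := by
    rw [div_sub_div _ _ (by positivity) (by positivity)]
    congr 1
    ring
  have e2 : 1 / (N ^ 2 + (b + 1) * N + (c + 1)) - 1 / (N ^ 2 + (b + 1) * N + (e + 1)) =
      (e - c) / ((N ^ 2 + (b + 1) * N + (c + 1)) * (N ^ 2 + (b + 1) * N + (e + 1))) := by
    rw [div_sub_div _ _ (by positivity) (by positivity)]
    congr 1
    ring
  have h1 : (e - c) / ((N ^ 2 + (b + 1) * N + (c + 1)) * (N ^ 2 + (b + 1) * N + (e + 1))) <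
      (e - c) / ((N ^ 2 + (a + 1) * N + (c + 1)) * (N ^ 2 + (a + 1) * N + (e + 1))) := by
    refine div_lt_div_of_pos_left (by linarith) (by positivity) ?_
    gcongr
  linarith

theorem isGeneric_dMax (hn : 4 ≤ n) : IsGeneric (dMax n) :=
  isGeneric_of_encard_tightPairs_le (isMetric_dMax n) fun _ hv =>
    encard_tightPairs_le (isMetric_dMax n) (fun _ _ _ hij hjk _ => dMax_triangle_lt hij hjk)
      (fun _ _ _ _ => dMax_crossing_left hn) (fun _ _ _ _ => dMax_crossing_right) hv

/-- When neighbouring indices coincide, both inequalities reduce to triangle inequalities or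
equalities; otherwise they are the strict crossing inequalities. -/
theorem exchangeInequalities_dMax (hn : 4 ≤ n) : ExchangeInequalities (dMax n) := by
  intro i j k l hij hjk hkl
  have hd := isMetric_dMax n
  rcases hij.eq_or_lt with rfl | hij
  · have := hd.triangle k i l
    have := hd.symm k i
    rw [hd.diag]
    constructor <;> linarith
  rcases hjk.eq_or_lt with rfl | hjk
  · have := hd.triangle i j l
    rw [hd.diag]
    constructor <;> linarith
  rcases hkl.eq_or_lt with rfl | hkl
  · have := hd.triangle i k j
    have := hd.symm k j
    rw [hd.diag]
    constructor <;> linarith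
  have h1 := dMax_crossing_left hn hij hjk hkl
  have h2 := dMax_crossing_right hij hjk hkl
  constructor <;> linarith

end DMax

theorem mainTheorem6 :
    (∀ (n : ℕ) (d : Fin n → Fin n → ℝ), 3 ≤ n →
      IsMetric d → IsGeneric d → ExchangeInequalities d →
        (Odd n → IsCell d (oddCycle n)) ∧ (Even n → IsCell d (evenCycleWithEdge n))) ∧
    (∀ n : ℕ, 4 ≤ n →
      IsMetric (dMax n) ∧ IsGeneric (dMax n) ∧ ExchangeInequalities (dMax n)) :=
  ⟨fun _ _ hn hd hgen hex =>
    ⟨isCell_oddCycle hn hd hgen hex, isCell_evenCycleWithEdge hn hd hgen hex⟩,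
    fun n hn => ⟨isMetric_dMax n, isGeneric_dMax hn, exchangeInequalities_dMax hn⟩⟩
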